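/- **Theorem 3.6.** All rings are commutative with one. A ring homomorphism $A\to B$ is *crisp* if $M\to M\otimes_A B$ is injective for every $A$-module $M$. A morphism of schemes $f\colon X\to Y$ is *locally quasi-compact surjective* if it is surjective and every quasi-compact open subset of $Y$ is the image of a quasi-compact open subset of $X$. A morphism of schemes $f\colon X\to Y$ is *crisp* if it is locally quasi-compact surjective and for every affine open $V\subseteq Y$ there are a quasi-compact open $U\subseteq f^{-1}(V)$ with $f(U)=V$ and a finite covering $U=U_1\cup\dots\cup U_r$ by affine opens such that the ring homomorphism $\Gamma(V,\mathcal O_Y)\to\prod_{i=1}^r\Gamma(U_i,\mathcal O_X)$ corresponding to $\bigsqcup_i U_i\to V$ is crisp. Let $S$ be a scheme. Call a small family $\{U_i\to U\}_{i\in I}$ of morphisms in $(\mathrm{Sch}/S)$ a *crisp covering* if the induced morphism $\bigsqcup_i U_i\to U$ is crisp, and an *fpqc covering* if $\bigsqcup_i U_i\to U$ is flat and locally quasi-compact surjective. Then: 1. The crisp coverings form a Grothendieck pretopology on $(\mathrm{Sch}/S)$: isomorphisms are coverings, and coverings are stable under base change and under composition. Whether a family is a crisp covering depends only on its set of arrows.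 2. Every fpqc covering is a crisp covering; hence the crisp topology is finer than the fpqc topology. 3. The crisp topology is subcanonical: every representable functor $(\mathrm{Sch}/S)^{\mathrm{op}}\to(\mathrm{Set})$ is a sheaf for the crisp topology. -/

import Mathlib

open CategoryTheory CategoryTheory.Limits AlgebraicGeometry
open scoped TensorProduct

universe u

/-- An `A`-linear map `g : M → N` is *crisp* (also called pure, or universally injective) if
`g ⊗ id_P : M ⊗ P → N ⊗ P` is injective for every `A`-module `P`. -/
def IsCrispLinearMap {A M N : Type u} [CommRing A] [AddCommGroup M] [AddCommGroup N]
    [Module A M] [Module A N] (g : M →ₗ[A] N) : Prop :=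
  ∀ (P : Type u) [AddCommGroup P] [Module A P], Function.Injective (g.rTensor P)

/-- A ring homomorphism `φ : A → B` is *crisp* if it is crisp as an `A`-linear map, where `B` is an
`A`-module through `φ`. -/
def IsCrispRingHom {A B : Type u} [CommRing A] [CommRing B] (φ : A →+* B) : Prop :=
  letI : Algebra A B := φ.toAlgebra
  IsCrispLinearMap (Algebra.linearMap A B)

/-- A morphism of schemes is *locally quasi-compact surjective* if it is surjective and every
quasi-compact open of the target is the image of a quasi-compact open of the source. -/
structure IsLocallyQuasiCompactSurjective {X Y : Scheme.{u}} (f : X ⟶ Y) : Prop where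
  surjective : Function.Surjective f
  exists_isCompact : ∀ V : Y.Opens, IsCompact (V : Set Y) →
    ∃ U : X.Opens, IsCompact (U : Set X) ∧ f '' (U : Set X) = (V : Set Y)

/-- A morphism of schemes `f : X ⟶ Y` is *crisp* if it is locally quasi-compact surjective and for
every affine open `V` of `Y` there are a quasi-compact open `U ⊆ f⁻¹(V)` with `f(U) = V` and a
finite covering of `U` by affine opens `W₁, …, Wᵣ` such that the ring homomorphism
`Γ(Y, V) → ∏ᵢ Γ(X, Wᵢ)`, which corresponds to the morphism of affine schemes `∐ᵢ Wᵢ ⟶ V` from the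
disjoint union, is crisp. -/
structure IsCrisp {X Y : Scheme.{u}} (f : X ⟶ Y) : Prop where
  locallyQuasiCompactSurjective : IsLocallyQuasiCompactSurjective f
  exists_cover : ∀ V : Y.Opens, IsAffineOpen V →
    ∃ U : X.Opens, IsCompact (U : Set X) ∧ U ≤ f ⁻¹ᵁ V ∧ f '' (U : Set X) = (V : Set Y) ∧
      ∃ (r : ℕ) (W : Fin r → X.Opens) (hW : ∀ i, W i ≤ f ⁻¹ᵁ V),
        (∀ i, IsAffineOpen (W i)) ∧ ⨆ i, W i = U ∧
          IsCrispRingHom (RingHom.pi fun i => (f.appLE V (W i) (hW i)).hom)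

/-- The morphism `∐ᵢ Uᵢ ⟶ X` of schemes induced by a family of morphisms `Uᵢ ⟶ X` over `S`. -/
noncomputable def inducedMap {S : Scheme.{u}} {X : Over S} {ι : Type u} {U : ι → Over S}
    (f : ∀ i, U i ⟶ X) : (∐ fun i => (U i).left) ⟶ X.left :=
  Sigma.desc fun i => (f i).left

/-- The family `{Uᵢ ⟶ X}` is a crisp covering: the induced morphism `∐ᵢ Uᵢ ⟶ X` is crisp. -/
def IsCrispFamily {S : Scheme.{u}} {X : Over S} {ι : Type u} {U : ι → Over S}
    (f : ∀ i, U i ⟶ X) : Prop :=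
  IsCrisp (inducedMap f)

/-- The family `{Uᵢ ⟶ X}` is an fpqc covering: the induced morphism `∐ᵢ Uᵢ ⟶ X` is faithfully flat
(flat and surjective) and locally quasi-compact surjective. -/
def IsFpqcFamily {S : Scheme.{u}} {X : Over S} {ι : Type u} {U : ι → Over S}
    (f : ∀ i, U i ⟶ X) : Prop :=
  Flat (inducedMap f) ∧ IsLocallyQuasiCompactSurjective (inducedMap f)

/-- The sets of arrows in `(Sch/S)` that are given by (small) crisp coverings. -/
def crispPrecoverage (S : Scheme.{u}) : Precoverage (Over S) where
  coverings X := {R | ∃ (ι : Type u) (U : ι → Over S) (f : ∀ i, U i ⟶ X),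
    R = Presieve.ofArrows U f ∧ IsCrispFamily f}

/-- The sets of arrows in `(Sch/S)` that are given by (small) fpqc coverings. -/
def fpqcPrecoverage (S : Scheme.{u}) : Precoverage (Over S) where
  coverings X := {R | ∃ (ι : Type u) (U : ι → Over S) (f : ∀ i, U i ⟶ X),
    R = Presieve.ofArrows U f ∧ IsFpqcFamily f}

/-!
Let `φ : A → B` be crisp. Every ideal `I` of `A` satisfies `IB ∩ A = I`. For primes `p ≤ p'` of `A`
this implies that the torsion of `B / pB` over the domain `A / p`, together with `p'B`, avoids the
image of `A ∖ p'`; so there are primes `q ≤ q'` of `B` over `p` and `p'`. Hence specializations lift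
along the surjection `Spec B → Spec A`, which is therefore a topological quotient map. A morphism
`Spec B ⟶ M` that coequalizes the kernel pair thus descends to a continuous map `Spec A → M`, and
locally to a morphism of schemes, because `b ⊗ 1 = 1 ⊗ b` in `B ⊗ B` only for `b` in `A`. The local
descents glue, as `Spec B ⟶ Spec A` and its base changes are epimorphisms.

The finite families of affine schemes that are jointly crisp, together with the Zariski coverings,
give a Grothendieck topology, and a family is a crisp covering exactly if it generates a covering
sieve for this topology. The axioms of a pretopology and subcanonicity for crisp coverings follow.
An fpqc covering is crisp since faithfully flat ring homomorphisms are crisp.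
-/

section Algebra

/-- The element `1 ⊗ p` of `B ⊗ P` vanishes, where `B` is an `A`-module through `φ : A → B`.
Crispness of `φ` says that this happens only for `p = 0`; as a predicate on `φ` it can be used for
families and composites without choosing compatible algebra structures. -/
def TensorVanishes {A B P : Type u} [CommRing A] [CommRing B] [AddCommGroup P] [Module A P]
    (φ : A →+* B) (p : P) : Prop :=
  letI : Algebra A B := φ.toAlgebra
  (1 : B) ⊗ₜ[A] p = 0

/-- A family of ring homomorphisms `φᵢ : A → Bᵢ` is *jointly crisp* if for every `A`-module `P`
the maps `P → Bᵢ ⊗ P` are jointly injective. For finite families this means that `A → ∏ᵢ Bᵢ` is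
crisp. -/
def IsJointlyCrisp {A : Type u} [CommRing A] {ι : Type*} {B : ι → Type u}
    [∀ i, CommRing (B i)] (φ : ∀ i, A →+* B i) : Prop :=
  ∀ (P : Type u) [AddCommGroup P] [Module A P] (p : P), (∀ i, TensorVanishes (φ i) p) → p = 0

variable {A B C P : Type u} [CommRing A] [CommRing B] [CommRing C] [AddCommGroup P] [Module A P]

lemma tensorVanishes_algebraMap_iff [Algebra A B] (p : P) :
    TensorVanishes (algebraMap A B) p ↔ (1 : B) ⊗ₜ[A] p = 0 := by
  rw [TensorVanishes, show (algebraMap A B).toAlgebra = ‹Algebra A B› from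
    Algebra.algebra_ext _ _ fun _ ↦ rfl]

lemma TensorVanishes.comp {φ : A →+* B} {p : P} (h : TensorVanishes φ p) (ψ : B →+* C) :
    TensorVanishes (ψ.comp φ) p := by
  algebraize [φ, ψ, ψ.comp φ]
  replace h : (1 : B) ⊗ₜ[A] p = 0 := h
  change (1 : C) ⊗ₜ[A] p = 0
  simpa using congr((IsScalarTower.toAlgHom A B C).toLinearMap.rTensor P $h)

lemma TensorVanishes.of_comp {φ : A →+* B} {ψ : B →+* C} {p : P}
    (h : TensorVanishes (ψ.comp φ) p) :
    letI : Algebra A B := φ.toAlgebra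
    TensorVanishes ψ ((1 : B) ⊗ₜ[A] p) := by
  algebraize [φ, ψ, ψ.comp φ]
  replace h : (1 : C) ⊗ₜ[A] p = 0 := h
  change (1 : C) ⊗ₜ[B] ((1 : B) ⊗ₜ[A] p) = 0
  apply (TensorProduct.AlgebraTensorModule.cancelBaseChange A B C C P).injective
  simpa using h

lemma TensorVanishes.of_baseChange {A' : Type u} [CommRing A'] [Algebra A A'] [Algebra A B]
    [Module A' P] [IsScalarTower A A' P] {p : P}
    (h : TensorVanishes (algebraMap A' (A' ⊗[A] B)) p) : TensorVanishes (algebraMap A B) p := by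
  rw [tensorVanishes_algebraMap_iff] at h ⊢
  apply (TensorProduct.comm A B P).injective
  have := congr(TensorProduct.AlgebraTensorModule.cancelBaseChange A A' A' P B
    (TensorProduct.comm A' _ P $h))
  simpa [Algebra.TensorProduct.one_def] using this

lemma tensorVanishes_pi_iff {ι : Type} [Finite ι] {B : ι → Type u} [∀ i, CommRing (B i)]
    (φ : ∀ i, A →+* B i) (p : P) :
    TensorVanishes (RingHom.pi φ) p ↔ ∀ i, TensorVanishes (φ i) p := by
  refine ⟨fun h i ↦ h.comp (Pi.evalRingHom B i), fun h ↦ ?_⟩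
  cases nonempty_fintype ι
  classical
  let (i : ι) : Algebra A (B i) := (φ i).toAlgebra
  change TensorVanishes (algebraMap A (∀ i, B i)) p
  rw [tensorVanishes_algebraMap_iff]
  apply (TensorProduct.comm A _ P).injective
  apply (TensorProduct.piRight A A P B).injective
  ext i
  have hi : (1 : B i) ⊗ₜ[A] p = 0 := h i
  simpa using congr(TensorProduct.comm A _ P $hi)

lemma isCrispRingHom_iff (φ : A →+* B) :
    IsCrispRingHom φ ↔ ∀ (P : Type u) [AddCommGroup P] [Module A P] (p : P),
      TensorVanishes φ p → p = 0 := by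
  algebraize [φ]
  change (∀ (P : Type u) [AddCommGroup P] [Module A P],
    Function.Injective ((Algebra.linearMap A B).rTensor P)) ↔ _
  refine forall_congr' fun P ↦ forall_congr' fun _ ↦ forall_congr' fun _ ↦ ?_
  rw [injective_iff_map_eq_zero]
  refine ⟨fun h p hp ↦ ?_, fun h x hx ↦ ?_⟩
  · replace hp : (1 : B) ⊗ₜ[A] p = 0 := hp
    simpa using h ((1 : A) ⊗ₜ p) (by simpa using hp)
  · obtain ⟨p, rfl⟩ := (TensorProduct.lid A P).symm.surjective x
    have hp : (1 : B) ⊗ₜ[A] p = 0 := by simpa using hx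
    simp [h p hp]

lemma isCrispRingHom_iff_isJointlyCrisp (φ : A →+* B) :
    IsCrispRingHom φ ↔ IsJointlyCrisp fun _ : Unit ↦ φ := by
  simp [isCrispRingHom_iff, IsJointlyCrisp]

lemma isCrispRingHom_pi_iff {ι : Type} [Finite ι] {B : ι → Type u} [∀ i, CommRing (B i)]
    (φ : ∀ i, A →+* B i) : IsCrispRingHom (RingHom.pi φ) ↔ IsJointlyCrisp φ := by
  simp only [isCrispRingHom_iff, tensorVanishes_pi_iff, IsJointlyCrisp]

section Family

variable {ι κ : Type*} {B : ι → Type u} [∀ i, CommRing (B i)] {φ : ∀ i, A →+* B i}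

lemma IsJointlyCrisp.of_factors {B' : κ → Type u} [∀ k, CommRing (B' k)] {ψ : ∀ k, A →+* B' k}
    (h : IsJointlyCrisp φ) (H : ∀ i, ∃ k, ∃ g : B' k →+* B i, g.comp (ψ k) = φ i) :
    IsJointlyCrisp ψ := by
  intro P _ _ p hp
  refine h P p fun i ↦ ?_
  obtain ⟨k, g, hg⟩ := H i
  rw [← hg]
  exact (hp k).comp g

lemma IsJointlyCrisp.comp {κ : ι → Type*} {C : ∀ i, κ i → Type u} [∀ i k, CommRing (C i k)]
    {ψ : ∀ i k, B i →+* C i k} (h : IsJointlyCrisp φ) (H : ∀ i, IsJointlyCrisp (ψ i)) :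
    IsJointlyCrisp (fun j : Σ i, κ i ↦ (ψ j.1 j.2).comp (φ j.1)) := by
  intro P _ _ p hp
  refine h P p fun i ↦ ?_
  algebraize [φ i]
  exact H i (B i ⊗[A] P) _ fun k ↦ (hp ⟨i, k⟩).of_comp

lemma IsJointlyCrisp.baseChange [∀ i, Algebra A (B i)]
    (h : IsJointlyCrisp fun i ↦ algebraMap A (B i)) (A' : Type u) [CommRing A'] [Algebra A A'] :
    IsJointlyCrisp fun i ↦ algebraMap A' (A' ⊗[A] B i) := by
  intro P _ _ p hp
  let : Module A P := Module.compHom P (algebraMap A A')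
  have : IsScalarTower A A' P := .of_algebraMap_smul fun _ _ ↦ rfl
  exact h P p fun i ↦ (hp i).of_baseChange

lemma isJointlyCrisp_id : IsJointlyCrisp fun _ : Unit ↦ RingHom.id A := by
  intro P _ _ p hp
  simpa using congr(TensorProduct.lid A P $((tensorVanishes_algebraMap_iff p).mp (hp ())))

end Family

lemma isCrispRingHom_of_faithfullyFlat {φ : A →+* B} (h : φ.FaithfullyFlat) :
    IsCrispRingHom φ := by
  rw [isCrispRingHom_iff]
  intro P _ _ p hp
  algebraize [φ]
  exact Module.FaithfullyFlat.tensorProduct_mk_injective (A := A) (B := B) P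
    (by simpa using (show (1 : B) ⊗ₜ[A] p = 0 from hp))

lemma isJointlyCrisp_of_flat {ι : Type} [Finite ι] {B : ι → Type u} [∀ i, CommRing (B i)]
    {φ : ∀ i, A →+* B i} (hφ : ∀ i, (φ i).Flat)
    (hs : ∀ p : PrimeSpectrum A, ∃ i, p ∈ Set.range (PrimeSpectrum.comap (φ i))) :
    IsJointlyCrisp φ := by
  rw [← isCrispRingHom_pi_iff]
  apply isCrispRingHom_of_faithfullyFlat
  rw [RingHom.FaithfullyFlat.iff_flat_and_comap_surjective]
  constructor
  · cases nonempty_fintype ι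
    let (i : ι) : Algebra A (B i) := (φ i).toAlgebra
    have (i : ι) : Module.Flat A (B i) := hφ i
    have : Module.Flat A (∀ i, B i) := .of_linearEquiv DFinsupp.linearEquivFunOnFintype.symm
    exact (RingHom.flat_algebraMap_iff (R := A) (S := ∀ i, B i)).mpr this
  · intro p
    obtain ⟨i, q, rfl⟩ := hs p
    exact ⟨q.comap (Pi.evalRingHom B i), rfl⟩

lemma IsCrispRingHom.comap_map {φ : A →+* B} (h : IsCrispRingHom φ) (I : Ideal A) :
    (I.map φ).comap φ = I := by
  refine le_antisymm (fun a ha ↦ ?_) Ideal.le_comap_map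
  rw [isCrispRingHom_iff] at h
  rw [← Ideal.Quotient.eq_zero_iff_mem]
  refine h (A ⧸ I) _ ?_
  algebraize [φ]
  change (1 : B) ⊗ₜ[A] (algebraMap A (A ⧸ I) a) = 0
  apply (Algebra.TensorProduct.quotIdealMapEquivTensorQuot B I).symm.injective
  rw [Algebra.algebraMap_eq_smul_one, TensorProduct.tmul_smul, TensorProduct.smul_tmul',
    ← Algebra.algebraMap_eq_smul_one, ← Algebra.TensorProduct.quotIdealMapEquivTensorQuot_mk,
    AlgEquiv.symm_apply_apply, map_zero]
  exact Ideal.Quotient.eq_zero_iff_mem.mpr ha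

lemma IsCrispRingHom.injective {φ : A →+* B} (h : IsCrispRingHom φ) : Function.Injective φ := by
  rw [RingHom.injective_iff_ker_eq_bot, RingHom.ker, ← Ideal.map_bot (f := φ), h.comap_map]

section Equalizer

variable [Algebra A B]

lemma IsCrispRingHom.mem_range_of_tmul_eq (h : IsCrispRingHom (algebraMap A B))
    {b : B} (hb : b ⊗ₜ[A] (1 : B) = 1 ⊗ₜ b) : b ∈ (algebraMap A B).range := by
  rw [isCrispRingHom_iff] at h
  let R := LinearMap.range (Algebra.linearMap A B)
  have : R.mkQ b = 0 := by
    refine h (B ⧸ R) _ ?_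
    rw [tensorVanishes_algebraMap_iff]
    have h1 : R.mkQ 1 = 0 := (Submodule.Quotient.mk_eq_zero _).mpr ⟨1, by simp⟩
    simpa [h1] using congr(R.mkQ.lTensor B $hb.symm)
  exact (Submodule.Quotient.mk_eq_zero _).mp this

lemma IsCrispRingHom.exists_comp_eq (h : IsCrispRingHom (algebraMap A B)) {θ : C →+* B}
    (hθ : ∀ c, θ c ⊗ₜ[A] (1 : B) = 1 ⊗ₜ θ c) : ∃ θ₀ : C →+* A, (algebraMap A B).comp θ₀ = θ := by
  let e : A ≃+* (algebraMap A B).range := .ofBijective (algebraMap A B).rangeRestrict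
    ⟨fun a a' haa' ↦ h.injective congr(($haa').1), (algebraMap A B).rangeRestrict_surjective⟩
  refine ⟨e.symm.toRingHom.comp (θ.codRestrict _ fun c ↦ h.mem_range_of_tmul_eq (hθ c)), ?_⟩
  ext c
  exact congr(($(e.apply_symm_apply ⟨θ c, h.mem_range_of_tmul_eq (hθ c)⟩)).1)

end Equalizer

end Algebra

section Topology

variable {A B : Type u} [CommRing A] [CommRing B] {φ : A →+* B}

/-- The ideal of `B` above `pB` whose image in `B / pB` is the torsion over the domain `A / p`.
Every prime of `B` containing it contains a prime lying over `p`. -/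
def torsionIdeal (φ : A →+* B) (p : Ideal A) [hp : p.IsPrime] : Ideal B where
  carrier := {b | ∃ a ∉ p, φ a * b ∈ p.map φ}
  zero_mem' := ⟨1, p.one_notMem, by simp⟩
  add_mem' := by
    rintro x y ⟨a, ha, hx⟩ ⟨b, hb, hy⟩
    refine ⟨a * b, hp.mul_notMem ha hb, ?_⟩
    rw [show φ (a * b) * (x + y) = φ b * (φ a * x) + φ a * (φ b * y) by rw [map_mul]; ring]
    exact add_mem (Ideal.mul_mem_left _ _ hx) (Ideal.mul_mem_left _ _ hy)
  smul_mem' := by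
    rintro c x ⟨a, ha, hx⟩
    refine ⟨a, ha, ?_⟩
    rw [smul_eq_mul, mul_left_comm]
    exact Ideal.mul_mem_left _ _ hx

lemma map_le_torsionIdeal (p : Ideal A) [p.IsPrime] : p.map φ ≤ torsionIdeal φ p :=
  fun b hb ↦ ⟨1, p.one_notMem, by simpa using hb⟩

lemma mem_torsionIdeal_of_mul_mem {p : Ideal A} [hp : p.IsPrime] {a : A} (ha : a ∉ p)
    {b : B} (h : φ a * b ∈ torsionIdeal φ p) : b ∈ torsionIdeal φ p := by
  obtain ⟨c, hc, h⟩ := h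
  refine ⟨c * a, hp.mul_notMem hc ha, ?_⟩
  rwa [map_mul, mul_assoc]

lemma IsCrispRingHom.disjoint_torsionIdeal_sup (h : IsCrispRingHom φ)
    {p p' : Ideal A} [hp : p.IsPrime] [p'.IsPrime] (hpp' : p ≤ p') :
    Disjoint ((torsionIdeal φ p ⊔ p'.map φ : Ideal B) : Set B)
      (p'.primeCompl.map φ : Submonoid B) := by
  rw [Set.disjoint_left]
  rintro _ hs ⟨s, hs', rfl⟩
  obtain ⟨t, ⟨a, ha, ht⟩, y, hy, hty⟩ := Submodule.mem_sup.mp hs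
  have hmem : a * s ∈ ((p ⊔ Ideal.span {a} * p').map φ).comap φ := by
    rw [Ideal.mem_comap, map_mul, ← hty, mul_add, Ideal.map_sup, Ideal.map_mul, Ideal.map_span,
      Set.image_singleton]
    exact Submodule.add_mem_sup ht (Ideal.mul_mem_mul (Ideal.mem_span_singleton_self _) hy)
  rw [h.comap_map] at hmem
  obtain ⟨x, hx, z, hz, hxz⟩ := Submodule.mem_sup.mp hmem
  obtain ⟨m, hm, rfl⟩ := Ideal.mem_span_singleton_mul.mp hz
  have hsm : a * (s - m) ∈ p := by rwa [mul_sub, ← hxz, add_sub_cancel_right]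
  have : s - m ∈ p' := hpp' ((hp.mem_or_mem hsm).resolve_left ha)
  exact hs' (by simpa using add_mem this hm)

lemma comap_eq_of_map_le_of_disjoint {p : Ideal A} [p.IsPrime] {q : Ideal B} (hle : p.map φ ≤ q)
    (hd : Disjoint (q : Set B) (p.primeCompl.map φ : Submonoid B)) : q.comap φ = p := by
  refine le_antisymm (fun a ha ↦ ?_) (Ideal.map_le_iff_le_comap.mp hle)
  by_contra hap
  exact Set.disjoint_left.mp hd ha ⟨a, hap, rfl⟩

lemma IsCrispRingHom.exists_comap_eq_of_le (h : IsCrispRingHom φ) {p p' : PrimeSpectrum A}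
    (hpp' : p ≤ p') : ∃ q q' : PrimeSpectrum B, q ≤ q' ∧ q.comap φ = p ∧ q'.comap φ = p' := by
  obtain ⟨q', hq', hle', hd'⟩ := Ideal.exists_le_prime_disjoint _ _
    (h.disjoint_torsionIdeal_sup (p := p.asIdeal) (p' := p'.asIdeal) hpp')
  have hd : Disjoint (torsionIdeal φ p.asIdeal : Set B)
      (p.asIdeal.primeCompl.map φ ⊔ q'.primeCompl : Submonoid B) := by
    rw [Set.disjoint_left]
    intro b hb hb'
    obtain ⟨_, ⟨a, ha, rfl⟩, t, ht, rfl⟩ := Submonoid.mem_sup.mp hb'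
    exact ht (hle' (le_sup_left (α := Ideal B) (mem_torsionIdeal_of_mul_mem ha hb)))
  obtain ⟨q, hq, hle, hd⟩ := Ideal.exists_le_prime_disjoint _ _ hd
  refine ⟨⟨q, hq⟩, ⟨q', hq'⟩, fun b hb ↦ ?_, ?_, ?_⟩
  · by_contra hbq
    exact Set.disjoint_left.mp hd hb (SetLike.le_def.mp le_sup_right hbq)
  · exact PrimeSpectrum.ext (comap_eq_of_map_le_of_disjoint ((map_le_torsionIdeal _).trans hle)
      (hd.mono_right (SetLike.coe_subset_coe.mpr le_sup_left)))
  · exact PrimeSpectrum.ext (comap_eq_of_map_le_of_disjoint (le_sup_right.trans hle') hd')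

lemma IsCrispRingHom.comap_surjective (h : IsCrispRingHom φ) :
    Function.Surjective (PrimeSpectrum.comap φ) := fun p ↦
  have ⟨q, _, _, hq, _⟩ := h.exists_comap_eq_of_le (le_refl p)
  ⟨q, hq⟩

lemma IsJointlyCrisp.exists_comap_eq {ι : Type} [Finite ι] {B : ι → Type u}
    [∀ i, CommRing (B i)] {φ : ∀ i, A →+* B i} (h : IsJointlyCrisp φ) (p : PrimeSpectrum A) :
    ∃ i, ∃ q : PrimeSpectrum (B i), q.comap (φ i) = p := by
  obtain ⟨q, rfl⟩ := ((isCrispRingHom_pi_iff φ).mpr h).comap_surjective p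
  obtain ⟨i, q, rfl⟩ := PrimeSpectrum.exists_comap_evalRingHom_eq q
  exact ⟨i, q, rfl⟩

/- If `comap φ ⁻¹ Z` is closed, then `Z` is its image, hence closed once it is stable under
specialization; that follows by lifting specializations along `φ`. -/
lemma IsCrispRingHom.isQuotientMap_comap (h : IsCrispRingHom φ) :
    Topology.IsQuotientMap (PrimeSpectrum.comap φ) := by
  refine Topology.isQuotientMap_iff_isClosed.mpr ⟨h.comap_surjective, fun Z ↦
    ⟨fun hZ ↦ hZ.preimage (PrimeSpectrum.continuous_comap φ), fun hZ ↦ ?_⟩⟩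
  have hZ_image := Set.image_preimage_eq Z h.comap_surjective
  rw [← hZ_image]
  refine PrimeSpectrum.isClosed_image_of_stableUnderSpecialization _ _ hZ ?_
  rw [hZ_image]
  intro x y hxy hx
  obtain ⟨q, q', hqq', rfl, rfl⟩ :=
    h.exists_comap_eq_of_le ((PrimeSpectrum.le_iff_specializes _ _).mpr hxy)
  exact hZ.stableUnderSpecialization ((PrimeSpectrum.le_iff_specializes _ _).mp hqq') hx

end Topology

section Topologies

lemma mem_of_forall_pullback_mem {𝒞 : Type*} [Category 𝒞] {J : GrothendieckTopology 𝒞} {X : 𝒞}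
    {ι : Type*} {Y : ι → 𝒞} {f : ∀ i, Y i ⟶ X} (hf : Sieve.ofArrows Y f ∈ J X) {R : Sieve X}
    (hR : ∀ i, R.pullback (f i) ∈ J (Y i)) : R ∈ J X := by
  refine J.transitive hf R ?_
  rintro Z _ ⟨_, g, _, ⟨i⟩, rfl⟩
  rw [Sieve.pullback_comp]
  exact J.pullback_stable g (hR i)

lemma mem_zariskiTopology_iff_forall_exists {X : Scheme.{u}} {R : Sieve X} :
    R ∈ Scheme.zariskiTopology X ↔
      ∀ x : X, ∃ (U : Scheme.{u}) (g : U ⟶ X), IsOpenImmersion g ∧ x ∈ Set.range g ∧ R g := by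
  refine ⟨fun hR x ↦ ?_, fun h ↦ ?_⟩
  · obtain ⟨𝒰, h𝒰⟩ := Scheme.exists_cover_of_mem_grothendieckTopology hR
    obtain ⟨i, hi⟩ := 𝒰.exists_eq x
    exact ⟨_, 𝒰.f i, inferInstance, hi, h𝒰 _ _ ⟨i⟩⟩
  · choose U g hg hx hR using h
    let 𝒰 : X.OpenCover := Scheme.Cover.mkOfCovers X U g (fun x ↦ ⟨x, hx x⟩)
    refine GrothendieckTopology.superset_covering _ ?_ 𝒰.mem_grothendieckTopology
    rw [Sieve.ofArrows, Sieve.generate_le_iff]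
    rintro _ _ ⟨x⟩
    exact hR x

/-- The crisp topology on the category of schemes: a sieve is covering if its pullback to every
affine scheme contains a finite jointly crisp family of affine schemes. The sieve generated by a
family is covering if and only if the family is a crisp covering, and in terms of sieves the
stability properties of crisp coverings become formal. -/
def crispTopology : GrothendieckTopology Scheme.{u} where
  sieves X := {R | ∀ (A : CommRingCat.{u}) (t : Spec A ⟶ X), ∃ (ι : Type) (_ : Finite ι)
    (B : ι → CommRingCat.{u}) (φ : ∀ i, A ⟶ B i), IsJointlyCrisp (fun i ↦ (φ i).hom) ∧
      ∀ i, R (Spec.map (φ i) ≫ t)}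
  top_mem' X A t := ⟨Unit, inferInstance, fun _ ↦ A, fun _ ↦ 𝟙 A, isJointlyCrisp_id,
    fun _ ↦ trivial⟩
  pullback_stable' X Y R f hR A t := by
    obtain ⟨ι, hι, B, φ, hφ, h⟩ := hR A (t ≫ f)
    exact ⟨ι, hι, B, φ, hφ, fun i ↦ by simpa using h i⟩
  transitive' X R hR T hT A t := by
    obtain ⟨ι, hι, B, φ, hφ, h⟩ := hR A t
    choose κ hκ C ψ hψ h' using fun i ↦ hT (h i) (B i) (𝟙 _)
    exact ⟨Σ i, κ i, inferInstance, fun j ↦ C j.1 j.2, fun j ↦ φ j.1 ≫ ψ j.1 j.2, hφ.comp hψ,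
      fun j ↦ by simpa using h' j.1 j.2⟩

lemma isJointlyCrisp_iff_mem_crispTopology {A : CommRingCat.{u}} {ι : Type} [Finite ι]
    {B : ι → CommRingCat.{u}} (φ : ∀ i, A ⟶ B i) :
    IsJointlyCrisp (fun i ↦ (φ i).hom) ↔
      Sieve.ofArrows (fun i ↦ Spec (B i)) (fun i ↦ Spec.map (φ i)) ∈ crispTopology (Spec A) := by
  refine ⟨fun hφ A' t ↦ ?_, fun h ↦ ?_⟩
  · obtain ⟨ψ, rfl⟩ := Spec.map_surjective t
    algebraize [ψ.hom]
    let (i : ι) : Algebra A (B i) := (φ i).hom.toAlgebra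
    refine ⟨ι, inferInstance, fun i ↦ .of (A' ⊗[A] B i), fun i ↦ CommRingCat.ofHom
      (algebraMap A' (A' ⊗[A] B i)), hφ.baseChange A', fun i ↦ ?_⟩
    have hψφ := (CommRingCat.isPushout_tensorProduct A A' (B i)).w
    exact ⟨_, Spec.map (CommRingCat.ofHom Algebra.TensorProduct.includeRight.toRingHom), _, ⟨i⟩,
      by simpa only [← Spec.map_comp] using! congr(Spec.map $hψφ.symm)⟩
  · obtain ⟨κ, _, C, ψ, hψ, H⟩ := h A (𝟙 _)
    refine hψ.of_factors fun k ↦ ?_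
    obtain ⟨_, g, _, ⟨i⟩, hg⟩ := H k
    obtain ⟨g, rfl⟩ := Spec.map_surjective g
    rw [Category.comp_id, ← Spec.map_comp] at hg
    exact ⟨i, g.hom, congr($(Spec.map_injective hg).hom)⟩

lemma exists_specMap_away_mem {A : CommRingCat.{u}} {R : Sieve (Spec A)}
    (hR : R ∈ Scheme.zariskiTopology (Spec A)) (p : PrimeSpectrum A) :
    ∃ a : A, p ∈ PrimeSpectrum.basicOpen a ∧
      R (Spec.map (CommRingCat.ofHom (algebraMap A (Localization.Away a)))) := by
  obtain ⟨U, g, _, hp, hg⟩ := mem_zariskiTopology_iff_forall_exists.mp hR p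
  obtain ⟨_, ⟨a, rfl⟩, hpa, haU⟩ :=
    PrimeSpectrum.isTopologicalBasis_basic_opens.exists_subset_of_mem_open hp
      g.isOpenEmbedding.isOpen_range
  refine ⟨a, hpa, ?_⟩
  rw [← IsOpenImmersion.lift_fac g (Spec.map (CommRingCat.ofHom (algebraMap A _)))
    ((PrimeSpectrum.localization_away_comap_range _ a).trans_subset haU)]
  exact R.downward_closed hg _

lemma zariskiTopology_le_crispTopology : Scheme.zariskiTopology.{u} ≤ crispTopology := by
  intro X R hR A t
  choose a ha hRa using exists_specMap_away_mem (Scheme.zariskiTopology.pullback_stable t hR)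
  obtain ⟨s, hs⟩ := CompactSpace.elim_nhds_subcover
    (fun p : PrimeSpectrum A ↦ (PrimeSpectrum.basicOpen (a p) : Set (PrimeSpectrum A)))
    fun p ↦ (PrimeSpectrum.basicOpen (a p)).isOpen.mem_nhds (ha p)
  let b (k : Fin s.card) : A := a (s.equivFin.symm k)
  refine ⟨Fin s.card, inferInstance, fun k ↦ .of (Localization.Away (b k)),
    fun k ↦ CommRingCat.ofHom (algebraMap A (Localization.Away (b k))),
    isJointlyCrisp_of_flat (fun k ↦ ?_) fun p ↦ ?_, fun k ↦ hRa _⟩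
  · have := IsLocalization.flat (Localization.Away (b k)) (.powers (b k))
    exact RingHom.flat_algebraMap_iff.mpr this
  · obtain ⟨q, hq, hpq⟩ := Set.mem_iUnion₂.mp (hs.ge (Set.mem_univ p))
    obtain ⟨k, rfl⟩ : ∃ k, (s.equivFin.symm k : PrimeSpectrum A) = q :=
      ⟨s.equivFin ⟨q, hq⟩, by rw [Equiv.symm_apply_apply]⟩
    exact ⟨k, (PrimeSpectrum.localization_away_comap_range _ (b k)).ge hpq⟩

end Topologies

section Descent

section DescentSieve

variable {𝒞 : Type*} [Category 𝒞] {X Y M : 𝒞}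

/-- Every pair of morphisms that `π` coequalizes is coequalized by `f`; if the kernel pair of `π`
exists, it suffices to know this for its two projections. -/
def CoequalizesKernelPair (π : X ⟶ Y) (f : X ⟶ M) : Prop :=
  ∀ ⦃W : 𝒞⦄ (k k' : W ⟶ X), k ≫ π = k' ≫ π → k ≫ f = k' ≫ f

/-- The sieve on `Y` of the morphisms `g` such that the base change of `f` to the source of `g`
descends along the base change of `π`. No fibre product is needed to express this. -/
def descentSieve (π : X ⟶ Y) (f : X ⟶ M) : Sieve Y where
  arrows Z g := ∃ u : Z ⟶ M, ∀ ⦃W : 𝒞⦄ (h : W ⟶ Z) (k : W ⟶ X), h ≫ g = k ≫ π → h ≫ u = k ≫ f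
  downward_closed := by
    rintro Z Z' g ⟨u, hu⟩ e
    refine ⟨e ≫ u, fun W h k hhk ↦ ?_⟩
    rw [← Category.assoc, hu (h ≫ e) k (by rw [Category.assoc, hhk])]

lemma exists_comp_eq_of_descentSieve_mem {J : GrothendieckTopology 𝒞} [J.Subcanonical]
    {π : X ⟶ Y} {f : X ⟶ M} (hf : CoequalizesKernelPair π f)
    (hsep : ∀ ⦃Z : 𝒞⦄ (g : Z ⟶ Y), Presieve.IsSeparatedFor (yoneda.obj M)
      ((Sieve.generate (.singleton π)).pullback g).arrows)
    (hJ : descentSieve π f ∈ J Y) : ∃ t : Y ⟶ M, π ≫ t = f := by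
  choose u hu using fun (Z : 𝒞) (g : Z ⟶ Y) (hg : descentSieve π f g) ↦ hg
  have hu_comp {Z W : 𝒞} (g : Z ⟶ Y) (e : W ⟶ Z) (hg : descentSieve π f g)
      (heg : descentSieve π f (e ≫ g)) : u W (e ≫ g) heg = e ≫ u Z g hg := by
    refine (hsep (e ≫ g)).ext fun V h ⟨_, k, _, ⟨⟩, hk⟩ ↦ ?_
    change h ≫ u W (e ≫ g) heg = h ≫ e ≫ u Z g hg
    rw [hu W _ heg h k hk.symm, ← Category.assoc, hu Z g hg (h ≫ e) k (by simpa using hk.symm)]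
  let x : Presieve.FamilyOfElements (yoneda.obj M) (descentSieve π f).arrows := u
  have hx : x.Compatible := (Presieve.compatible_iff_sieveCompatible x).mpr
    fun Z W g e hg ↦ hu_comp g e hg _
  obtain ⟨t, ht, -⟩ := GrothendieckTopology.Subcanonical.isSheaf_of_isRepresentable
    (J := J) (yoneda.obj M) _ hJ x hx
  have hπ : descentSieve π f π := ⟨f, hf⟩
  refine ⟨t, (ht π hπ).trans ?_⟩
  simpa using hu X π hπ (𝟙 X) (𝟙 X) rfl

end DescentSieve

lemma IsCrispRingHom.epi_specMap {A B : CommRingCat.{u}} {φ : A ⟶ B}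
    (h : IsCrispRingHom φ.hom) : Epi (Spec.map φ) := by
  refine ⟨fun {Z} a b hab ↦ ?_⟩
  let l := equalizer.lift (f := a) (g := b) (Spec.map φ) hab
  have hl : l ≫ equalizer.ι a b = Spec.map φ := equalizer.lift_ι _ _
  have hclosed : IsClosedImmersion (equalizer.ι a b) := by
    refine .of_isPreimmersion _ ?_
    rw [Set.range_eq_univ.mpr fun p ↦ ?_]
    · exact isClosed_univ
    · obtain ⟨q, rfl⟩ := h.comap_surjective p
      exact ⟨l q, congr($hl q)⟩
  have hinj : Function.Injective (equalizer.ι a b).appTop := by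
    have hφ : Function.Injective ((Spec.map φ).appTop ≫ (Scheme.ΓSpecIso B).hom).hom := by
      rw [Scheme.ΓSpecIso_naturality]
      exact h.injective.comp (Scheme.ΓSpecIso A).commRingCatIsoToRingEquiv.injective
    rw [← hl, Scheme.Hom.comp_appTop, Category.assoc, CommRingCat.hom_comp, RingHom.coe_comp] at hφ
    exact hφ.of_comp
  have : IsIso (equalizer.ι a b) := IsClosedImmersion.isIso_of_injective_of_isAffine hinj
  rw [← cancel_epi (equalizer.ι a b)]
  exact equalizer.condition a b

lemma exists_isCrispRingHom_pullback_mem_zariskiTopology {A : CommRingCat.{u}}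
    {R : Sieve (Spec A)} (hR : R ∈ crispTopology (Spec A)) :
    ∃ (B : CommRingCat.{u}) (φ : A ⟶ B), IsCrispRingHom φ.hom ∧
      R.pullback (Spec.map φ) ∈ Scheme.zariskiTopology (Spec B) := by
  obtain ⟨ι, _, B, φ, hφ, hB⟩ := hR _ (𝟙 _)
  refine ⟨.of (∀ i, B i), CommRingCat.ofHom (RingHom.pi fun i ↦ (φ i).hom),
    (isCrispRingHom_pi_iff _).mpr hφ, mem_zariskiTopology_iff_forall_exists.mpr fun p ↦ ?_⟩
  obtain ⟨i, q, rfl⟩ := PrimeSpectrum.exists_comap_evalRingHom_eq p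
  refine ⟨_, Spec.map (CommRingCat.ofHom (Pi.evalRingHom (fun i ↦ B i) i)), inferInstance,
    ⟨q, rfl⟩, ?_⟩
  rw [Sieve.pullback_apply, ← Spec.map_comp]
  simpa only [Category.comp_id] using! hB i

lemma isSeparatedFor_yoneda_of_mem_crispTopology {X : Scheme.{u}} (M : Scheme.{u}) {R : Sieve X}
    (hR : R ∈ crispTopology X) : Presieve.IsSeparatedFor (yoneda.obj M) R.arrows := by
  intro x a b ha hb
  have hab {Z : Scheme.{u}} (g : Z ⟶ X) (hg : R g) : g ≫ a = g ≫ b := (ha g hg).trans (hb g hg).symm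
  have hab_affine {A : CommRingCat.{u}} (t : Spec A ⟶ X) : t ≫ a = t ≫ b := by
    obtain ⟨B, φ, hφ, hB⟩ := exists_isCrispRingHom_pullback_mem_zariskiTopology
      (crispTopology.pullback_stable t hR)
    have := hφ.epi_specMap
    rw [← cancel_epi (Spec.map φ)]
    refine (GrothendieckTopology.Subcanonical.isSheaf_of_isRepresentable
      (yoneda.obj M) _ hB).isSeparatedFor.ext fun Z g hg ↦ ?_
    simpa using hab _ hg
  exact X.affineCover.hom_ext _ _ fun i ↦ hab_affine _

lemma IsCrispRingHom.generate_mem_crispTopology {A B : CommRingCat.{u}} {φ : A ⟶ B}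
    (h : IsCrispRingHom φ.hom) :
    Sieve.generate (.singleton (Spec.map φ)) ∈ crispTopology (Spec A) := by
  rw [isCrispRingHom_iff_isJointlyCrisp] at h
  have := (isJointlyCrisp_iff_mem_crispTopology fun _ : Unit ↦ φ).mp h
  rwa [Sieve.ofArrows, Presieve.ofArrows_pUnit] at this

lemma CoequalizesKernelPair.exists_continuousMap {X Y M : Scheme.{u}} {π : X ⟶ Y} {f : X ⟶ M}
    (hf : CoequalizesKernelPair π f) (hπ : Topology.IsQuotientMap π) :
    ∃ b : C(Y, M), ∀ x, b (π x) = f x := by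
  have hfib (x x' : X) (h : π x = π x') : f x = f x' := by
    obtain ⟨z, rfl, rfl⟩ := Scheme.Pullback.exists_preimage_pullback x x' h
    simpa only [Scheme.Hom.comp_apply] using
      congr($(hf (pullback.fst π π) (pullback.snd π π) pullback.condition) z)
  let π' : C(X, Y) := ⟨π, π.continuous⟩
  have hπ' : Topology.IsQuotientMap π' := hπ
  exact ⟨hπ'.lift ⟨f, f.continuous⟩ hfib,
    DFunLike.congr_fun (hπ'.lift_comp ⟨f, f.continuous⟩ hfib)⟩

lemma IsCrispRingHom.exists_specMap_comp_eq_of_isAffine {A B : CommRingCat.{u}} {φ : A ⟶ B}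
    (h : IsCrispRingHom φ.hom) {M : Scheme.{u}} [IsAffine M] {f : Spec B ⟶ M}
    (hf : CoequalizesKernelPair (Spec.map φ) f) : ∃ u : Spec A ⟶ M, Spec.map φ ≫ u = f := by
  algebraize [φ.hom]
  obtain ⟨θ, hθ⟩ := Spec.map_surjective (f ≫ M.isoSpec.hom)
  let i₁ : B ⟶ .of (B ⊗[A] B) := CommRingCat.ofHom Algebra.TensorProduct.includeLeftRingHom
  let i₂ : B ⟶ .of (B ⊗[A] B) :=
    CommRingCat.ofHom Algebra.TensorProduct.includeRight.toRingHom
  have hi : φ ≫ i₁ = φ ≫ i₂ := (CommRingCat.isPushout_tensorProduct A B B).w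
  have hf₁₂ := hf (Spec.map i₁) (Spec.map i₂) (by simp only [← Spec.map_comp, hi])
  have hθ₁₂ : θ ≫ i₁ = θ ≫ i₂ := Spec.map_injective <| by
    rw [Spec.map_comp, Spec.map_comp, hθ, reassoc_of% hf₁₂]
  obtain ⟨θ₀, hθ₀⟩ := IsCrispRingHom.exists_comp_eq (A := A) (B := B) h (θ := θ.hom)
    fun c ↦ congr($hθ₁₂ c)
  refine ⟨Spec.map (CommRingCat.ofHom θ₀) ≫ M.isoSpec.inv, ?_⟩
  rw [← Spec.map_comp_assoc, Iso.comp_inv_eq, ← hθ]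
  exact congr(Spec.map $(CommRingCat.hom_ext hθ₀))

lemma IsCrispRingHom.exists_isPullback {A A' B : CommRingCat.{u}} {φ : A ⟶ B}
    (h : IsCrispRingHom φ.hom) (j : Spec A' ⟶ Spec A) :
    ∃ (B' : CommRingCat.{u}) (φ' : A' ⟶ B') (l : Spec B' ⟶ Spec B), IsCrispRingHom φ'.hom ∧
      IsPullback (Spec.map φ') l j (Spec.map φ) := by
  obtain ⟨ψ, rfl⟩ := Spec.map_surjective j
  algebraize [φ.hom, ψ.hom]
  rw [isCrispRingHom_iff_isJointlyCrisp] at h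
  exact ⟨.of (A' ⊗[A] B), CommRingCat.ofHom (algebraMap A' (A' ⊗[A] B)),
    Spec.map (CommRingCat.ofHom Algebra.TensorProduct.includeRight.toRingHom),
    (isCrispRingHom_iff_isJointlyCrisp _).mpr (IsJointlyCrisp.baseChange h A'),
    isPullback_SpecMap_of_isPushout _ _ _ _ (CommRingCat.isPushout_tensorProduct A A' B)⟩

lemma IsCrispRingHom.descentSieve_apply_of_forall_mem {A A' B : CommRingCat.{u}} {φ : A ⟶ B}
    (h : IsCrispRingHom φ.hom) {M : Scheme.{u}} {f : Spec B ⟶ M}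
    (hf : CoequalizesKernelPair (Spec.map φ) f) {V : M.Opens} (hV : IsAffineOpen V)
    {j : Spec A' ⟶ Spec A} (hj : ∀ x, Spec.map φ x ∈ Set.range j → f x ∈ V) :
    descentSieve (Spec.map φ) f j := by
  obtain ⟨B', φ', l, hφ', hpb⟩ := h.exists_isPullback j
  have hlV : Set.range (l ≫ f) ⊆ Set.range hV.fromSpec := by
    rintro _ ⟨x, rfl⟩
    rw [hV.range_fromSpec, Scheme.Hom.comp_apply]
    exact hj (l x) ⟨Spec.map φ' x, congr($hpb.w x)⟩
  let f' := IsOpenImmersion.lift hV.fromSpec (l ≫ f) hlV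
  have hf' : f' ≫ hV.fromSpec = l ≫ f := IsOpenImmersion.lift_fac _ _ _
  have hf'_coequalizes : CoequalizesKernelPair (Spec.map φ') f' := fun W k k' hkk' ↦ by
    have hl : k ≫ l ≫ f = k' ≫ l ≫ f := by
      simpa only [Category.assoc] using hf (k ≫ l) (k' ≫ l)
        (by simp only [Category.assoc, ← hpb.w, reassoc_of% hkk'])
    simpa only [← cancel_mono hV.fromSpec, Category.assoc, hf'] using hl
  obtain ⟨u, hu⟩ := hφ'.exists_specMap_comp_eq_of_isAffine hf'_coequalizes
  refine ⟨u ≫ hV.fromSpec, fun W g k hgk ↦ ?_⟩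
  calc g ≫ u ≫ hV.fromSpec
      = hpb.lift g k hgk ≫ (Spec.map φ' ≫ u) ≫ hV.fromSpec := by
        simp only [Category.assoc, hpb.lift_fst_assoc]
    _ = k ≫ f := by rw [hu, hf', hpb.lift_snd_assoc]

lemma IsCrispRingHom.descentSieve_mem_zariskiTopology {A B : CommRingCat.{u}} {φ : A ⟶ B}
    (h : IsCrispRingHom φ.hom) {M : Scheme.{u}} {f : Spec B ⟶ M}
    (hf : CoequalizesKernelPair (Spec.map φ) f) :
    descentSieve (Spec.map φ) f ∈ Scheme.zariskiTopology (Spec A) := by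
  obtain ⟨b, hb⟩ := hf.exists_continuousMap h.isQuotientMap_comap
  refine mem_zariskiTopology_iff_forall_exists.mpr fun p ↦ ?_
  obtain ⟨_, ⟨V, hV, rfl⟩, hpV, -⟩ :=
    M.isBasis_affineOpens.exists_subset_of_mem_open (Set.mem_univ (b p)) isOpen_univ
  obtain ⟨_, ⟨U, hU, rfl⟩, hpU, hUV⟩ := (Spec A).isBasis_affineOpens.exists_subset_of_mem_open
    (show p ∈ b ⁻¹' V from hpV) (V.isOpen.preimage b.continuous)
  refine ⟨_, hU.fromSpec, hU.isOpenImmersion_fromSpec, hU.range_fromSpec.ge hpU,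
    h.descentSieve_apply_of_forall_mem hf hV fun x hx ↦ ?_⟩
  rw [hU.range_fromSpec] at hx
  simpa only [Set.mem_preimage, hb] using! hUV hx

lemma IsCrispRingHom.isSheafFor_singleton {A B : CommRingCat.{u}} {φ : A ⟶ B}
    (h : IsCrispRingHom φ.hom) (M : Scheme.{u}) :
    Presieve.IsSheafFor (yoneda.obj M) (.singleton (Spec.map φ)) := by
  rw [Presieve.isSheafFor_singleton]
  intro f hf
  replace hf : CoequalizesKernelPair (Spec.map φ) f := fun _ ↦ hf
  have := h.epi_specMap
  obtain ⟨t, ht⟩ := exists_comp_eq_of_descentSieve_mem (J := Scheme.zariskiTopology) hf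
    (fun Z g ↦ isSeparatedFor_yoneda_of_mem_crispTopology M
      (crispTopology.pullback_stable g h.generate_mem_crispTopology))
    (h.descentSieve_mem_zariskiTopology hf)
  exact ⟨t, ht, fun t' ht' ↦ (cancel_epi (Spec.map φ)).mp (ht'.trans ht.symm)⟩

lemma isSheafFor_yoneda_of_mem_crispTopology_spec {A : CommRingCat.{u}} (M : Scheme.{u})
    {R : Sieve (Spec A)} (hR : R ∈ crispTopology (Spec A)) :
    Presieve.IsSheafFor (yoneda.obj M) R.arrows := by
  obtain ⟨B, φ, hφ, hB⟩ := exists_isCrispRingHom_pullback_mem_zariskiTopology hR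
  refine Presieve.isSheafFor_trans _ (.generate (.singleton (Spec.map φ))) R ?_ ?_ ?_
  · exact (Presieve.isSheafFor_iff_generate _).mp (hφ.isSheafFor_singleton M)
  · exact fun Z g _ ↦ isSeparatedFor_yoneda_of_mem_crispTopology M
      (crispTopology.pullback_stable g hφ.generate_mem_crispTopology)
  · rintro Z _ ⟨_, g, _, ⟨⟩, rfl⟩
    rw [Sieve.pullback_comp]
    exact GrothendieckTopology.Subcanonical.isSheaf_of_isRepresentable (yoneda.obj M) _
      (Scheme.zariskiTopology.pullback_stable g hB)

instance subcanonical_crispTopology : crispTopology.{u}.Subcanonical := by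
  refine GrothendieckTopology.Subcanonical.of_isSheaf_yoneda_obj _ fun M X R hR ↦ ?_
  refine X.affineOneHypercover.isSheafFor_of_pullback
    (GrothendieckTopology.Subcanonical.isSheaf_of_isRepresentable _) (fun i ↦ ?_)
    (fun i j k ↦ ?_)
  · rw [Sieve.generate_sieve]
    exact isSheafFor_yoneda_of_mem_crispTopology_spec M (crispTopology.pullback_stable _ hR)
  · rw [Sieve.generate_sieve]
    exact isSeparatedFor_yoneda_of_mem_crispTopology M (crispTopology.pullback_stable _ hR)

end Descent

section Comparison

lemma exists_finite_affine_cover {X : Scheme.{u}} {C : Set X} (hC : IsCompact C) (U : X.Opens)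
    (hCU : C ⊆ U) : ∃ (r : ℕ) (W : Fin r → X.Opens), (∀ i, IsAffineOpen (W i)) ∧
      (∀ i, W i ≤ U) ∧ C ⊆ (⨆ i, W i : X.Opens) := by
  obtain ⟨t, ht⟩ := hC.elim_finite_subcover
    (fun W : {W : X.Opens // IsAffineOpen W ∧ W ≤ U} ↦ (W.1 : Set X)) (fun W ↦ W.1.isOpen) <| by
    intro x hx
    obtain ⟨_, ⟨W, hW, rfl⟩, hxW, hWU⟩ :=
      X.isBasis_affineOpens.exists_subset_of_mem_open (hCU hx) U.isOpen
    exact Set.mem_iUnion.mpr ⟨⟨W, hW, hWU⟩, hxW⟩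
  refine ⟨t.card, fun i ↦ (t.equivFin.symm i).1.1, fun i ↦ (t.equivFin.symm i).1.2.1,
    fun i ↦ (t.equivFin.symm i).1.2.2, fun x hx ↦ ?_⟩
  obtain ⟨W, hW, hxW⟩ := Set.mem_iUnion₂.mp (ht hx)
  rw [SetLike.mem_coe, TopologicalSpace.Opens.mem_iSup]
  exact ⟨t.equivFin ⟨W, hW⟩, by simpa using hxW⟩

lemma IsLocallyQuasiCompactSurjective.of_affine {X Y : Scheme.{u}} {f : X ⟶ Y}
    (H : ∀ V : Y.Opens, IsAffineOpen V →
      ∃ U : X.Opens, IsCompact (U : Set X) ∧ f '' (U : Set X) = (V : Set Y)) :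
    IsLocallyQuasiCompactSurjective f where
  surjective y := by
    obtain ⟨_, ⟨V, hV, rfl⟩, hyV, -⟩ :=
      Y.isBasis_affineOpens.exists_subset_of_mem_open (Set.mem_univ y) isOpen_univ
    obtain ⟨U, -, hU⟩ := H V hV
    rw [← hU] at hyV
    obtain ⟨x, -, hx⟩ := hyV
    exact ⟨x, hx⟩
  exists_isCompact V hV := by
    refine compact_open_induction_on (P := fun V ↦ ∃ U : X.Opens, IsCompact (U : Set X) ∧
      f '' (U : Set X) = (V : Set Y)) V hV ⟨⊥, by simp, by simp⟩ ?_
    rintro S - V ⟨U, hU, hUS⟩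
    obtain ⟨U', hU', hUV⟩ := H V V.2
    refine ⟨U ⊔ U', by simpa using hU.union hU', ?_⟩
    simp [Set.image_union, hUS, hUV]

lemma specMap_appLE_eq_iff {X Y : Scheme.{u}} {f : X ⟶ Y} {V : Y.Opens}
    (hV : IsAffineOpen V) {W : X.Opens} (hW : IsAffineOpen W) (e : W ≤ f ⁻¹ᵁ V)
    (q : Spec Γ(X, W)) (p : Spec Γ(Y, V)) :
    Spec.map (f.appLE V W e) q = p ↔ f (hW.fromSpec q) = hV.fromSpec p := by
  rw [← hV.fromSpec.isOpenEmbedding.injective.eq_iff, ← Scheme.Hom.comp_apply,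
    hV.SpecMap_appLE_fromSpec f hW e, Scheme.Hom.comp_apply]

lemma IsCrisp.of_flat {X Y : Scheme.{u}} {f : X ⟶ Y} [Flat f]
    (hf : IsLocallyQuasiCompactSurjective f) : IsCrisp f where
  locallyQuasiCompactSurjective := hf
  exists_cover V hV := by
    obtain ⟨U, hU, hUV⟩ := hf.exists_isCompact V hV.isCompact
    have hle : U ≤ f ⁻¹ᵁ V := fun x hx ↦ hUV.le ⟨x, hx, rfl⟩
    obtain ⟨r, W, hW, hWU, hUW⟩ := exists_finite_affine_cover hU U subset_rfl
    refine ⟨U, hU, hle, hUV, r, W, fun i ↦ (hWU i).trans hle, hW,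
      le_antisymm (iSup_le hWU) hUW, (isCrispRingHom_pi_iff _).mpr <|
      isJointlyCrisp_of_flat (fun i ↦ f.flat_appLE hV (hW i) _) fun p ↦ ?_⟩
    obtain ⟨x, hx, hxp⟩ : hV.fromSpec p ∈ f '' (U : Set X) := by
      rw [hUV, ← hV.range_fromSpec]
      exact ⟨p, rfl⟩
    obtain ⟨i, hxi⟩ := TopologicalSpace.Opens.mem_iSup.mp (hUW hx)
    obtain ⟨q, rfl⟩ := (hW i).range_fromSpec.ge hxi
    exact ⟨i, q, (specMap_appLE_eq_iff hV (hW i) _ q p).mpr hxp⟩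

lemma ofArrows_fromSpec_mem_zariskiTopology (Y : Scheme.{u}) :
    Sieve.ofArrows (fun V : Y.affineOpens ↦ Spec Γ(Y, V)) (fun V ↦ V.2.fromSpec) ∈
      Scheme.zariskiTopology Y := by
  refine mem_zariskiTopology_iff_forall_exists.mpr fun y ↦ ?_
  obtain ⟨_, ⟨V, hV, rfl⟩, hyV, -⟩ :=
    Y.isBasis_affineOpens.exists_subset_of_mem_open (Set.mem_univ y) isOpen_univ
  exact ⟨_, hV.fromSpec, hV.isOpenImmersion_fromSpec, hV.range_fromSpec.ge hyV,
    Sieve.ofArrows_mk _ _ (⟨V, hV⟩ : Y.affineOpens)⟩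

lemma IsCrisp.mem_crispTopology {X Y : Scheme.{u}} {f : X ⟶ Y} (hf : IsCrisp f) :
    Sieve.generate (.singleton f) ∈ crispTopology Y := by
  refine mem_of_forall_pullback_mem
    (zariskiTopology_le_crispTopology _ (ofArrows_fromSpec_mem_zariskiTopology Y)) fun V ↦ ?_
  obtain ⟨U, -, -, -, r, W, hWV, hW, -, h⟩ := hf.exists_cover V V.2
  refine crispTopology.superset_covering ?_
    ((isJointlyCrisp_iff_mem_crispTopology _).mp ((isCrispRingHom_pi_iff _).mp h))
  rw [Sieve.ofArrows, Sieve.generate_le_iff]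
  rintro _ _ ⟨i⟩
  exact ⟨_, (hW i).fromSpec, f, ⟨⟩, (V.2.SpecMap_appLE_fromSpec f (hW i) _).symm⟩

section

variable {X Y : Scheme.{u}} {f : X ⟶ Y} {V : Y.Opens} {hV : IsAffineOpen V} {ι : Type} [Finite ι]
  {B : ι → CommRingCat.{u}} {φ : ∀ i, Γ(Y, V) ⟶ B i} {g : ∀ i, Spec (B i) ⟶ X}

lemma IsJointlyCrisp.image_eq (hφ : IsJointlyCrisp fun i ↦ (φ i).hom)
    (hg : ∀ i, g i ≫ f = Spec.map (φ i) ≫ hV.fromSpec) {U : X.Opens} (hUV : U ≤ f ⁻¹ᵁ V)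
    (hgU : ∀ i, Set.range (g i) ⊆ U) : f '' (U : Set X) = V := by
  refine subset_antisymm (Set.image_subset_iff.mpr hUV) fun y hy ↦ ?_
  obtain ⟨p, rfl⟩ := hV.range_fromSpec.ge hy
  obtain ⟨i, q, rfl⟩ := hφ.exists_comap_eq p
  exact ⟨g i q, hgU i ⟨q, rfl⟩, congr($(hg i) q)⟩

lemma IsJointlyCrisp.appLE (hφ : IsJointlyCrisp fun i ↦ (φ i).hom)
    (hg : ∀ i, g i ≫ f = Spec.map (φ i) ≫ hV.fromSpec) {κ : Type} [Finite κ] {W : κ → X.Opens}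
    (hW : ∀ k, IsAffineOpen (W k)) (hWV : ∀ k, W k ≤ f ⁻¹ᵁ V)
    (hgW : ∀ i, Set.range (g i) ⊆ (⨆ k, W k : X.Opens)) :
    IsJointlyCrisp fun k ↦ (f.appLE V (W k) (hWV k)).hom := by
  rw [isJointlyCrisp_iff_mem_crispTopology] at hφ ⊢
  refine mem_of_forall_pullback_mem hφ fun i ↦ zariskiTopology_le_crispTopology _ <|
    mem_zariskiTopology_iff_forall_exists.mpr fun x ↦ ?_
  obtain ⟨k, hk⟩ := TopologicalSpace.Opens.mem_iSup.mp (hgW i ⟨x, rfl⟩)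
  let O := g i ⁻¹ᵁ W k
  refine ⟨O, O.ι, inferInstance, ⟨⟨x, hk⟩, rfl⟩, ?_⟩
  have hO : Set.range (O.ι ≫ g i) ⊆ Set.range (hW k).fromSpec := by
    rw [(hW k).range_fromSpec]
    rintro _ ⟨x, rfl⟩
    exact x.2
  refine ⟨_, IsOpenImmersion.lift (hW k).fromSpec (O.ι ≫ g i) hO, _, ⟨k⟩, ?_⟩
  rw [← cancel_mono hV.fromSpec, Category.assoc, Category.assoc,
    hV.SpecMap_appLE_fromSpec f (hW k), IsOpenImmersion.lift_fac_assoc, Category.assoc, hg]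

end

lemma exists_affine_cover_of_mem_crispTopology {X Y : Scheme.{u}} {f : X ⟶ Y}
    (hf : Sieve.generate (.singleton f) ∈ crispTopology Y) {V : Y.Opens} (hV : IsAffineOpen V) :
    ∃ (r : ℕ) (W : Fin r → X.Opens) (hW : ∀ i, W i ≤ f ⁻¹ᵁ V), (∀ i, IsAffineOpen (W i)) ∧
      f '' (⨆ i, W i : X.Opens) = (V : Set Y) ∧
      IsCrispRingHom (RingHom.pi fun i ↦ (f.appLE V (W i) (hW i)).hom) := by
  obtain ⟨ι, _, B, φ, hφ, h⟩ := hf _ hV.fromSpec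
  have hlift (i : ι) : ∃ g : Spec (B i) ⟶ X, g ≫ f = Spec.map (φ i) ≫ hV.fromSpec :=
    have ⟨_, g, _, ⟨⟩, h⟩ := h i
    ⟨g, h⟩
  choose g hg using hlift
  have hgV : ⋃ i, Set.range (g i) ⊆ (f ⁻¹ᵁ V : X.Opens) := by
    rw [Set.iUnion_subset_iff]
    rintro i _ ⟨x, rfl⟩
    change f (g i x) ∈ (V : Set Y)
    rw [← Scheme.Hom.comp_apply, hg, ← hV.range_fromSpec]
    exact ⟨_, rfl⟩
  obtain ⟨r, W, hW, hWV, hgW⟩ := exists_finite_affine_cover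
    (isCompact_iUnion fun i ↦ isCompact_range (g i).continuous) _ hgV
  rw [Set.iUnion_subset_iff] at hgW
  exact ⟨r, W, hWV, hW, hφ.image_eq hg (iSup_le hWV) hgW,
    (isCrispRingHom_pi_iff _).mpr (hφ.appLE hg hW hWV hgW)⟩

lemma IsCrisp.of_mem_crispTopology {X Y : Scheme.{u}} {f : X ⟶ Y}
    (hf : Sieve.generate (.singleton f) ∈ crispTopology Y) : IsCrisp f := by
  have hcompact {r : ℕ} {W : Fin r → X.Opens} (hW : ∀ i, IsAffineOpen (W i)) :
      IsCompact ((⨆ i, W i : X.Opens) : Set X) := by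
    rw [TopologicalSpace.Opens.coe_iSup]
    exact isCompact_iUnion fun i ↦ (hW i).isCompact
  refine ⟨.of_affine fun V hV ↦ ?_, fun V hV ↦ ?_⟩ <;>
    obtain ⟨r, W, hWV, hW, hfW, h⟩ := exists_affine_cover_of_mem_crispTopology hf hV
  · exact ⟨_, hcompact hW, hfW⟩
  · exact ⟨_, hcompact hW, iSup_le hWV, hfW, r, W, hWV, hW, rfl, h⟩

lemma isCrisp_iff_mem_crispTopology {X Y : Scheme.{u}} (f : X ⟶ Y) :
    IsCrisp f ↔ Sieve.generate (.singleton f) ∈ crispTopology Y :=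
  ⟨fun h ↦ h.mem_crispTopology, .of_mem_crispTopology⟩

end Comparison

section Pretopology

variable {S : Scheme.{u}}

lemma isCrisp_sigmaDesc_iff {X : Scheme.{u}} {ι : Type u} {U : ι → Scheme.{u}}
    (f : ∀ i, U i ⟶ X) :
    IsCrisp (Sigma.desc f) ↔ Sieve.ofArrows U f ∈ crispTopology X := by
  rw [isCrisp_iff_mem_crispTopology]
  refine ⟨fun h ↦ crispTopology.transitive h _ ?_, fun h ↦ crispTopology.superset_covering ?_ h⟩
  · rintro Z _ ⟨_, g, _, ⟨⟩, rfl⟩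
    rw [Sieve.pullback_comp]
    refine crispTopology.pullback_stable g (crispTopology.superset_covering ?_
      (zariskiTopology_le_crispTopology _ (sigmaOpenCover U).mem_grothendieckTopology))
    rw [Sieve.generate_le_iff]
    rintro _ _ ⟨i⟩
    exact ⟨_, 𝟙 _, _, ⟨i⟩, (Category.id_comp _).trans (Sigma.ι_desc _ _).symm⟩
  · rw [Sieve.ofArrows, Sieve.generate_le_iff]
    rintro _ _ ⟨i⟩
    exact ⟨_, Sigma.ι U i, _, ⟨⟩, Sigma.ι_desc _ _⟩

lemma overEquiv_generate_ofArrows {X : Over S} {ι : Type u} {U : ι → Over S}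
    (f : ∀ i, U i ⟶ X) : Sieve.overEquiv X (Sieve.generate (Presieve.ofArrows U f)) =
      Sieve.ofArrows (fun i ↦ (U i).left) (fun i ↦ (f i).left) := by
  ext Z g
  rw [Sieve.overEquiv_iff]
  constructor
  · rintro ⟨_, h, _, ⟨i⟩, hg⟩
    exact ⟨_, h.left, _, ⟨i⟩, congr(($hg).left)⟩
  · rintro ⟨_, h, _, ⟨i⟩, rfl⟩
    exact ⟨_, Over.homMk h (by simp), _, ⟨i⟩, by ext; simp⟩

lemma isCrispFamily_iff {X : Over S} {ι : Type u} {U : ι → Over S} (f : ∀ i, U i ⟶ X) :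
    IsCrispFamily f ↔
      Presieve.ofArrows U f ∈ (crispTopology.over S).toPretopology X := by
  rw [GrothendieckTopology.mem_toPretopology, GrothendieckTopology.mem_over_iff,
    overEquiv_generate_ofArrows]
  exact isCrisp_sigmaDesc_iff _

lemma mem_crispPrecoverage_iff {X : Over S} (R : Presieve X) :
    R ∈ (crispPrecoverage S).coverings X ↔
      (∃ (ι : Type u) (U : ι → Over S) (f : ∀ i, U i ⟶ X), R = Presieve.ofArrows U f) ∧
        R ∈ (crispTopology.over S).toPretopology X := by
  constructor
  · rintro ⟨ι, U, f, rfl, h⟩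
    exact ⟨⟨ι, U, f, rfl⟩, (isCrispFamily_iff f).mp h⟩
  · rintro ⟨⟨ι, U, f, rfl⟩, h⟩
    exact ⟨ι, U, f, rfl, (isCrispFamily_iff f).mpr h⟩

/-- The pretopology on schemes over `S` given by the crisp coverings. -/
def crispPretopology (S : Scheme.{u}) : Pretopology (Over S) where
  toPrecoverage := crispPrecoverage S
  has_isos X Y f _ := by
    rw [mem_crispPrecoverage_iff]
    exact ⟨⟨PUnit, _, _, (Presieve.ofArrows_pUnit f).symm⟩, Pretopology.has_isos _ f⟩
  pullbacks X Y f R hR := by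
    rw [mem_crispPrecoverage_iff] at hR ⊢
    refine ⟨?_, Pretopology.pullbacks _ f R hR.2⟩
    obtain ⟨⟨ι, U, g, rfl⟩, -⟩ := hR
    exact ⟨ι, _, _, (Presieve.ofArrows_pullback f U g).symm⟩
  transitive X R Ti hR hTi := by
    simp only [mem_crispPrecoverage_iff] at hR hTi ⊢
    refine ⟨?_, Pretopology.transitive _ R Ti hR.2 fun Y f H ↦ (hTi f H).2⟩
    obtain ⟨⟨ι, U, g, rfl⟩, -⟩ := hR
    choose κ W k hk using fun Y f H ↦ (hTi (Y := Y) f H).1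
    obtain rfl : Ti = fun Y f H ↦ Presieve.ofArrows (W Y f H) (k Y f H) := by
      funext Y f H
      exact hk Y f H
    exact ⟨_, _, _, Presieve.ofArrows_bind U g _ _ _⟩

lemma crispPretopology_toGrothendieck_le (S : Scheme.{u}) :
    (crispPretopology S).toGrothendieck ≤ crispTopology.over S := by
  rintro X R ⟨T, hT, hTR⟩
  exact GrothendieckTopology.superset_covering _ ((Sieve.generate_le_iff _ _).mpr hTR)
    ((mem_crispPrecoverage_iff T).mp hT).2

lemma fpqcPrecoverage_le_crispPrecoverage (S : Scheme.{u}) :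
    fpqcPrecoverage S ≤ crispPrecoverage S := by
  rintro X _ ⟨ι, U, f, rfl, hflat, hf⟩
  exact ⟨ι, U, f, rfl, .of_flat hf⟩

end Pretopology

theorem theorem3p6 (S : Scheme.{u}) :
    ∃ K : Pretopology (Over S),
      K.toPrecoverage = crispPrecoverage S ∧
      (∀ (X : Over S) (ι : Type u) (U : ι → Over S) (f : ∀ i, U i ⟶ X),
        Presieve.ofArrows U f ∈ K X ↔ IsCrispFamily f) ∧
      fpqcPrecoverage S ≤ K.toPrecoverage ∧
      (fpqcPrecoverage S).toGrothendieck ≤ K.toGrothendieck ∧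
      K.toGrothendieck.Subcanonical ∧
      ∀ F : (Over S)ᵒᵖ ⥤ Type u, F.IsRepresentable →
        Presieve.IsSheaf K.toGrothendieck F := by
  have hsub : (crispPretopology S).toGrothendieck.Subcanonical :=
    .of_le (crispPretopology_toGrothendieck_le S)
  refine ⟨crispPretopology S, rfl, fun X ι U f ↦ ?_, fpqcPrecoverage_le_crispPrecoverage S, ?_,
    hsub, fun F _ ↦ GrothendieckTopology.Subcanonical.isSheaf_of_isRepresentable F⟩
  · rw [isCrispFamily_iff]
    exact (mem_crispPrecoverage_iff _).trans (and_iff_right ⟨ι, U, f, rfl⟩)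
  · rw [Precoverage.toGrothendieck_le_iff_le_toPrecoverage]
    intro X R hR
    exact ⟨R, fpqcPrecoverage_le_crispPrecoverage S X hR, Sieve.le_generate R⟩
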